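/- Let $d\in\mathbb{N}$. A quantum operation on $\mathcal{B}(\mathbb{C}^d)$ is a trace-preserving completely positive map $\mathcal{E}(\rho)=\sum_{i=1}^m E_i\rho E_i^\dagger$ with $\sum_i E_i^\dagger E_i=I$. For density operators put $\tilde F(\rho_0,\rho_1)=\max\{|\langle\psi_0|\psi_1\rangle| : \psi_k\in\mathrm{supp}(\rho_k),\ \|\psi_k\|=1\}$, where $\mathrm{supp}(\rho)$ is the span of the eigenvectors of $\rho$ with positive eigenvalue. For quantum operations $\mathcal{E}_0,\mathcal{E}_1$ put $$\tilde F_q(\mathcal{E}_0,\mathcal{E}_1)=\min\{\tilde F(\mathcal{E}_0(|\psi_0\rangle\langle\psi_0|),\mathcal{E}_1(|\psi_1\rangle\langle\psi_1|)) : \|\psi_0\|=\|\psi_1\|=1,\ \langle\psi_0|\psi_1\rangle=q\},$$ and $\tilde F^{ea}_q(\mathcal{E}_0,\mathcal{E}_1)=\tilde F_q(\mathcal{I}^R\otimes\mathcal{E}_0,\mathcal{I}^R\otimes\mathcal{E}_1)$, where $R$ is an auxiliary system of dimension $d$ and $\mathcal{I}$ denotes the identity operation. A general (entanglement-assisted)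 scheme with $n$ queries to an unknown operation $X$ on $\mathcal{B}(\mathbb{C}^d)$ prepares a state of $\mathbb{C}^{r_0}\otimes\mathbb{C}^d$ and then, for $k=0,\dots,n-1$, applies $\mathcal{I}\otimes X$ followed by a fixed quantum operation from $\mathcal{B}(\mathbb{C}^{r_k}\otimes\mathbb{C}^d)$ to $\mathcal{B}(\mathbb{C}^{r_{k+1}}\otimes\mathbb{C}^d)$; the auxiliary dimensions $r_k$ are arbitrary. Two operations are perfectly distinguishable with $n$ queries if, for some such scheme, some two-outcome measurement tells the two final states apart with certainty; they are perfectly distinguishable if this holds for some $n$, and then $N_{\min}$ is the least such $n$. Statement. Let $U$ be a unitary on $\mathbb{C}^d$ and $\mathcal{E}$ a quantum operation on $\mathcal{B}(\mathbb{C}^d)$, and let $\mathcal{E}'(\rho)=U^\dagger\mathcal{E}(\rho)U$ (so that $\mathcal{E}'=\mathcal{E}$ if $U=I$). If the operation $\rho\mapsto U\rho U^\dagger$ and $\mathcal{E}$ are perfectly distinguishable, then $\tilde F^{ea}_1(\mathcal{E}',\mathcal{I})<1$, and their optimal query number satisfies $$N_{\min}\ \ge\ \left\lceil\frac{\pi}{2\arccos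 \tilde F^{ea}_1(\mathcal{E}',\mathcal{I})}\right\rceil .$$ -/

import Mathlib

open scoped ComplexOrder Matrix

noncomputable section

namespace QDisc

/-- Linear maps `B(ℋ_ι) → B(ℋ_κ)`, operators being written as matrices in the standard bases. -/
abbrev SuperOp (ι κ : Type) : Type := Matrix ι ι ℂ →ₗ[ℂ] Matrix κ κ ℂ

/-- `ρ` is a density operator: positive, with trace one. -/
def IsDensity {ι : Type} [Fintype ι] (ρ : Matrix ι ι ℂ) : Prop :=
  ρ.PosSemidef ∧ ρ.trace = 1

/-- `Φ` is a quantum operation: `Φ(ρ) = ∑ᵢ Eᵢ ρ Eᵢ†` for finitely many Kraus operators `Eᵢ` with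
`∑ᵢ Eᵢ† Eᵢ = I` (in finite dimension, exactly the trace-preserving completely positive maps). -/
def IsQuantumOperation {ι κ : Type} [Fintype ι] [DecidableEq ι] [Fintype κ]
    (Φ : SuperOp ι κ) : Prop :=
  ∃ (m : ℕ) (E : Fin m → Matrix κ ι ℂ),
    (∑ i, (E i)ᴴ * E i = 1) ∧ ∀ ρ : Matrix ι ι ℂ, Φ ρ = ∑ i, E i * ρ * (E i)ᴴ

/-- The operation `ρ ↦ A ρ A†`. -/
def conjOp {ι : Type} [Fintype ι] (A : Matrix ι ι ℂ) : SuperOp ι ι where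
  toFun ρ := A * ρ * Aᴴ
  map_add' ρ σ := by rw [Matrix.mul_add, Matrix.add_mul]
  map_smul' c ρ := by simp

/-- `ℐ^R ⊗ Φ`: `Φ` applied to the second tensor factor, that is, to each of the blocks
`ρ_{rs}` of `ρ = ∑ |r⟩⟨s| ⊗ ρ_{rs}`. -/
def idTensor (R : Type) {ι κ : Type} (Φ : SuperOp ι κ) : SuperOp (R × ι) (R × κ) where
  toFun ρ := Matrix.of fun x y => Φ (Matrix.of fun i j => ρ (x.1, i) (y.1, j)) x.2 y.2
  map_add' ρ σ := by
    ext x y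
    exact congrFun (congrFun (Φ.map_add (Matrix.of fun i j => ρ (x.1, i) (y.1, j))
      (Matrix.of fun i j => σ (x.1, i) (y.1, j))) x.2) y.2
  map_smul' c ρ := by
    ext x y
    exact congrFun (congrFun (Φ.map_smul c (Matrix.of fun i j => ρ (x.1, i) (y.1, j))) x.2) y.2

/-- The density operator `|ψ⟩⟨ψ|` of a vector `ψ`. -/
def pureState {ι : Type} (ψ : EuclideanSpace ℂ ι) : Matrix ι ι ℂ :=
  Matrix.of fun i j => ψ i * star (ψ j)

/-- The support of a state: the range of `ρ`, which for a positive `ρ` is the span of its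
eigenvectors with positive eigenvalue. -/
def supp {ι : Type} [Fintype ι] [DecidableEq ι] (ρ : Matrix ι ι ℂ) :
    Submodule ℂ (EuclideanSpace ℂ ι) :=
  LinearMap.range (Matrix.toEuclideanLin ρ)

/-- The maximal fidelity of two states: the largest overlap of unit vectors in their supports. -/
def maxFidelity {ι : Type} [Fintype ι] [DecidableEq ι] (ρ₀ ρ₁ : Matrix ι ι ℂ) : ℝ :=
  sSup {x : ℝ | ∃ φ₀ ∈ supp ρ₀, ∃ φ₁ ∈ supp ρ₁,
    ‖φ₀‖ = 1 ∧ ‖φ₁‖ = 1 ∧ x = ‖inner ℂ φ₀ φ₁‖}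

/-- The `q`-maximal fidelity of two quantum operations: the least maximal fidelity of their outputs
on pure inputs with inner product `q`. -/
def qMaxFidelity {ι κ : Type} [Fintype ι] [Fintype κ] [DecidableEq κ]
    (q : ℝ) (Φ₀ Φ₁ : SuperOp ι κ) : ℝ :=
  sInf {x : ℝ | ∃ ψ₀ ψ₁ : EuclideanSpace ℂ ι, ‖ψ₀‖ = 1 ∧ ‖ψ₁‖ = 1 ∧
    inner ℂ ψ₀ ψ₁ = (q : ℂ) ∧ x = maxFidelity (Φ₀ (pureState ψ₀)) (Φ₁ (pureState ψ₁))}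

/-- The entanglement-assisted `q`-maximal fidelity; the auxiliary system has the dimension of the
input system. -/
def eaMaxFidelity {ι κ : Type} [Fintype ι] [Fintype κ] [DecidableEq ι] [DecidableEq κ]
    (q : ℝ) (Φ₀ Φ₁ : SuperOp ι κ) : ℝ :=
  qMaxFidelity q (idTensor ι Φ₀) (idTensor ι Φ₁)

/-- A general (adaptive, entanglement-assisted) scheme for querying an unknown operation on `ℋ_ι`.
An initial state, possibly mixed and entangled, of an auxiliary system and the queried system is
prepared; after the `k`-th query (`k = 0, 1, …`) a known quantum operation `op k` is applied
jointly to both systems, which may also change the dimension `aux k` of the auxiliary system. -/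
structure Scheme (ι : Type) [Fintype ι] [DecidableEq ι] where
  aux : ℕ → ℕ
  init : Matrix (Fin (aux 0) × ι) (Fin (aux 0) × ι) ℂ
  init_isDensity : IsDensity init
  op : ∀ k, SuperOp (Fin (aux k) × ι) (Fin (aux (k + 1)) × ι)
  op_isQuantumOperation : ∀ k, IsQuantumOperation (op k)

/-- The joint state after `n` queries to the operation `X` (and the known operations that follow
each of them). -/
def Scheme.state {ι : Type} [Fintype ι] [DecidableEq ι] (S : Scheme ι) (X : SuperOp ι ι) :
    ∀ n : ℕ, Matrix (Fin (S.aux n) × ι) (Fin (S.aux n) × ι) ℂ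
  | 0 => S.init
  | n + 1 => S.op n (idTensor (Fin (S.aux n)) X (S.state X n))

/-- Some two-outcome measurement `{M, 1 - M}` identifies with certainty which of the two states
`ρ₀`, `ρ₁` is present. -/
def PerfectlyDistinguishableStates {ι : Type} [Fintype ι] [DecidableEq ι]
    (ρ₀ ρ₁ : Matrix ι ι ℂ) : Prop :=
  ∃ M : Matrix ι ι ℂ, M.PosSemidef ∧ (1 - M).PosSemidef ∧
    (M * ρ₀).trace = 1 ∧ ((1 - M) * ρ₁).trace = 1

/-- Some general scheme identifies with certainty, by `n` queries, which of `X₀`, `X₁` is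
queried. -/
def DistinguishableIn {ι : Type} [Fintype ι] [DecidableEq ι] (n : ℕ) (X₀ X₁ : SuperOp ι ι) :
    Prop :=
  ∃ S : Scheme ι, PerfectlyDistinguishableStates (S.state X₀ n) (S.state X₁ n)

/-- Perfect distinguishability by finitely many queries. -/
def PerfectlyDistinguishable {ι : Type} [Fintype ι] [DecidableEq ι] (X₀ X₁ : SuperOp ι ι) :
    Prop :=
  ∃ n : ℕ, DistinguishableIn n X₀ X₁

/-- The optimal number of queries `N_min` (meaningful for perfectly distinguishable operations). -/
def minQueries {ι : Type} [Fintype ι] [DecidableEq ι] (X₀ X₁ : SuperOp ι ι) : ℕ :=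
  sInf {n : ℕ | DistinguishableIn n X₀ X₁}

end QDisc

end

namespace QDisc

open scoped Kronecker
open Matrix (toEuclideanLin)

set_option linter.unusedSectionVars false

variable {ι κ : Type} [Fintype ι] [DecidableEq ι] [Fintype κ] [DecidableEq κ]

/-! ### Matrices acting on Euclidean space -/

/-! Follow one unit vector in the support of each of the two final states, and measure the pair by
the angle `arccos ‖⟨φ₀, φ₁⟩‖`. Both runs start in the same state, so the angle can start at `0`.
Write `F` for the entanglement-assisted fidelity. A query sends `φ₀` to `Uφ₀`, while the support of
the other output contains every combination `w` of the vectors `Kᵢφ₁`. Some unit `w` has overlap at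
least `F` with `Uφ₁` (`exists_query_overlap`). Since `U` preserves the old angle, the triangle
inequality (`cos_add_le_norm_inner`) adds at most `arccos F`. A fixed operation between queries
cannot lower the best overlap (`exists_kraus_overlap`). Perfect discrimination makes the supports
orthogonal, so `n * arccos F ≥ π / 2`. This gives both `F < 1` and the bound. -/

theorem toEuclideanLin_mul_apply {μ : Type} [Fintype μ] [DecidableEq μ]
    (A : Matrix μ κ ℂ) (B : Matrix κ ι ℂ) (x : EuclideanSpace ℂ ι) :
    toEuclideanLin (A * B) x = toEuclideanLin A (toEuclideanLin B x) := by
  rw [Matrix.toEuclideanLin, Matrix.toLpLin_mul]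
  rfl

theorem inner_toEuclideanLin_left (A : Matrix κ ι ℂ) (x : EuclideanSpace ℂ ι)
    (y : EuclideanSpace ℂ κ) :
    inner ℂ (toEuclideanLin A x) y = inner ℂ x (toEuclideanLin Aᴴ y) := by
  rw [Matrix.toEuclideanLin_conjTranspose_eq_adjoint, LinearMap.adjoint_inner_right]

theorem inner_toEuclideanLin_right (A : Matrix κ ι ℂ) (x : EuclideanSpace ℂ κ)
    (y : EuclideanSpace ℂ ι) :
    inner ℂ x (toEuclideanLin A y) = inner ℂ (toEuclideanLin Aᴴ x) y := by
  rw [Matrix.toEuclideanLin_conjTranspose_eq_adjoint, LinearMap.adjoint_inner_left]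

theorem sum_inner_kraus {m : ℕ} {K : Fin m → Matrix κ ι ℂ} (hK : ∑ i, (K i)ᴴ * K i = 1)
    (a b : EuclideanSpace ℂ ι) :
    ∑ i, inner ℂ (toEuclideanLin (K i) a) (toEuclideanLin (K i) b) = inner ℂ a b := by
  simp_rw [inner_toEuclideanLin_left, ← toEuclideanLin_mul_apply]
  rw [← inner_sum, ← LinearMap.sum_apply, ← map_sum, hK]
  simp [Matrix.toEuclideanLin]

theorem toEuclideanLin_eq_zero_of_posSemidef {ρ : Matrix ι ι ℂ} (hρ : ρ.PosSemidef)
    {x : EuclideanSpace ℂ ι} (hx : inner ℂ x (toEuclideanLin ρ x) = 0) :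
    toEuclideanLin ρ x = 0 := by
  have h := (hρ.dotProduct_mulVec_zero_iff x.ofLp).1 (by
    rw [EuclideanSpace.inner_eq_star_dotProduct, dotProduct_comm] at hx
    simpa using hx)
  ext i
  simpa using congrFun h i

/-! ### Supports -/

/-- The range of a Hermitian matrix is the orthogonal complement of its kernel; positivity arguments
control the kernel. -/
theorem mem_supp_iff {ρ : Matrix ι ι ℂ} (hρ : ρ.IsHermitian) {φ : EuclideanSpace ℂ ι} :
    φ ∈ supp ρ ↔ ∀ x, toEuclideanLin ρ x = 0 → inner ℂ x φ = 0 := by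
  have hs := Matrix.isSymmetric_toEuclideanLin_iff.2 hρ
  rw [supp, ← Submodule.orthogonal_orthogonal (LinearMap.range (toEuclideanLin ρ)),
    hs.orthogonal_range, Submodule.mem_orthogonal]
  rfl

theorem toEuclideanLin_pureState (φ x : EuclideanSpace ℂ ι) :
    toEuclideanLin (pureState φ) x = inner ℂ φ x • φ := by
  ext i
  simp only [pureState, Matrix.ofLp_toLpLin, Matrix.toLin'_apply, Matrix.mulVec, dotProduct,
    Matrix.of_apply, PiLp.smul_apply, smul_eq_mul, EuclideanSpace.inner_eq_star_dotProduct,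
    Finset.sum_mul, Pi.star_apply]
  exact Finset.sum_congr rfl fun j _ => by ring

theorem mul_pureState_mul (K : Matrix κ ι ℂ) (φ : EuclideanSpace ℂ ι) :
    K * pureState φ * Kᴴ = pureState (toEuclideanLin K φ) := by
  apply Matrix.toEuclideanLin.injective
  ext1 x
  rw [toEuclideanLin_mul_apply, toEuclideanLin_mul_apply, toEuclideanLin_pureState,
    toEuclideanLin_pureState, map_smul, inner_toEuclideanLin_left]

theorem exists_eq_smul_of_mem_supp_pureState {φ w : EuclideanSpace ℂ ι}
    (hw : w ∈ supp (pureState φ)) : ∃ c : ℂ, w = c • φ := by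
  obtain ⟨x, rfl⟩ := hw
  exact ⟨_, toEuclideanLin_pureState φ x⟩

theorem posSemidef_kraus {m : ℕ} (K : Fin m → Matrix κ ι ℂ) {ρ : Matrix ι ι ℂ}
    (hρ : ρ.PosSemidef) : (∑ i, K i * ρ * (K i)ᴴ).PosSemidef :=
  Matrix.posSemidef_sum _ fun i _ => hρ.mul_mul_conjTranspose_same (K i)

/-- If `x` is in the kernel of the output, the nonnegative numbers `⟨Kᵢ†x, ρKᵢ†x⟩` sum to zero, so
each `Kᵢ†x` lies in the kernel of `ρ`. -/
theorem kraus_mem_supp {m : ℕ} (K : Fin m → Matrix κ ι ℂ) {ρ : Matrix ι ι ℂ}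
    (hρ : ρ.PosSemidef) {φ : EuclideanSpace ℂ ι} (hφ : φ ∈ supp ρ) (j : Fin m) :
    toEuclideanLin (K j) φ ∈ supp (∑ i, K i * ρ * (K i)ᴴ) := by
  rw [mem_supp_iff (posSemidef_kraus K hρ).1]
  intro x hx
  rw [inner_toEuclideanLin_right]
  refine (mem_supp_iff hρ.1).1 hφ _ (toEuclideanLin_eq_zero_of_posSemidef hρ ?_)
  have hsum : ∑ i, inner ℂ (toEuclideanLin (K i)ᴴ x)
      (toEuclideanLin ρ (toEuclideanLin (K i)ᴴ x)) = 0 := by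
    have : inner ℂ x (toEuclideanLin (∑ i, K i * ρ * (K i)ᴴ) x) = 0 := by rw [hx, inner_zero_right]
    rw [← this, map_sum, LinearMap.sum_apply, inner_sum]
    refine Finset.sum_congr rfl fun i _ => ?_
    rw [toEuclideanLin_mul_apply, toEuclideanLin_mul_apply, inner_toEuclideanLin_left,
      Matrix.conjTranspose_conjTranspose]
  refine (Finset.sum_eq_zero_iff_of_nonneg fun i _ => ?_).1 hsum j (Finset.mem_univ j)
  have := hρ.dotProduct_mulVec_nonneg (toEuclideanLin (K i)ᴴ x).ofLp
  rw [EuclideanSpace.inner_eq_star_dotProduct, dotProduct_comm]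
  simpa using this

theorem exists_eq_sum_of_mem_supp_kraus {m : ℕ} (K : Fin m → Matrix κ ι ℂ)
    (φ : EuclideanSpace ℂ ι) {w : EuclideanSpace ℂ κ}
    (hw : w ∈ supp (∑ i, K i * pureState φ * (K i)ᴴ)) :
    ∃ c : Fin m → ℂ, w = ∑ i, c i • toEuclideanLin (K i) φ := by
  obtain ⟨x, rfl⟩ := hw
  refine ⟨fun i => inner ℂ (toEuclideanLin (K i) φ) x, ?_⟩
  rw [map_sum, LinearMap.sum_apply]
  exact Finset.sum_congr rfl fun i _ => by rw [mul_pureState_mul, toEuclideanLin_pureState]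

/-! ### Kraus representations and density operators -/

theorem IsQuantumOperation.isDensity {Φ : SuperOp ι κ} (hΦ : IsQuantumOperation Φ)
    {ρ : Matrix ι ι ℂ} (hρ : IsDensity ρ) : IsDensity (Φ ρ) := by
  obtain ⟨m, K, hK, hΦ⟩ := hΦ
  rw [hΦ]
  refine ⟨posSemidef_kraus K hρ.1, ?_⟩
  rw [Matrix.trace_sum]
  rw [Finset.sum_congr rfl fun i _ => Matrix.trace_mul_cycle (K i) ρ (K i)ᴴ,
    ← Matrix.trace_sum, ← Finset.sum_mul, hK, one_mul, hρ.2]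

theorem idTensor_kraus (R : Type) [Fintype R] [DecidableEq R] {Φ : SuperOp ι κ} {m : ℕ}
    {K : Fin m → Matrix κ ι ℂ} (hΦ : ∀ ρ, Φ ρ = ∑ i, K i * ρ * (K i)ᴴ)
    (ρ : Matrix (R × ι) (R × ι) ℂ) :
    idTensor R Φ ρ = ∑ i, ((1 : Matrix R R ℂ) ⊗ₖ K i) * ρ * ((1 : Matrix R R ℂ) ⊗ₖ K i)ᴴ := by
  ext ⟨r, x⟩ ⟨s, y⟩
  simp only [idTensor, LinearMap.coe_mk, AddHom.coe_mk, Matrix.of_apply, hΦ, Matrix.sum_apply]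
  refine Finset.sum_congr rfl fun i _ => ?_
  simp [Matrix.mul_apply, Fintype.sum_prod_type, Matrix.one_apply, apply_ite (starRingEnd ℂ),
    Finset.sum_ite_irrel]

theorem IsQuantumOperation.idTensor (R : Type) [Fintype R] [DecidableEq R] {Φ : SuperOp ι κ}
    (hΦ : IsQuantumOperation Φ) : IsQuantumOperation (idTensor R Φ) := by
  obtain ⟨m, K, hK, hΦ⟩ := hΦ
  refine ⟨m, fun i => (1 : Matrix R R ℂ) ⊗ₖ K i, ?_, idTensor_kraus R hΦ⟩
  simp_rw [Matrix.conjTranspose_kronecker, ← Matrix.mul_kronecker_mul]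
  rw [Matrix.conjTranspose_one, one_mul, ← Matrix.one_kronecker_one, ← hK]
  ext ⟨r, x⟩ ⟨s, y⟩
  simp [Matrix.sum_apply, Finset.mul_sum]

theorem conjOp_isQuantumOperation {U : Matrix ι ι ℂ} (hU : Uᴴ * U = 1) :
    IsQuantumOperation (conjOp U) :=
  ⟨1, fun _ => U, by simpa using hU, fun ρ => by simp [conjOp]⟩

theorem Scheme.state_isDensity (S : Scheme ι) {X : SuperOp ι ι} (hX : IsQuantumOperation X) :
    ∀ n, IsDensity (S.state X n)
  | 0 => S.init_isDensity
  | n + 1 => (S.op_isQuantumOperation n).isDensity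
      ((hX.idTensor _).isDensity (S.state_isDensity hX n))

theorem IsDensity.exists_mem_supp {ρ : Matrix ι ι ℂ} (hρ : IsDensity ρ) :
    ∃ φ ∈ supp ρ, ‖φ‖ = 1 := by
  obtain ⟨φ, hφ, h0⟩ : ∃ φ ∈ supp ρ, φ ≠ 0 := by
    by_contra! h
    have : ρ = 0 := by
      apply Matrix.toEuclideanLin.injective
      ext1 x
      rw [h _ ⟨x, rfl⟩]
      simp
    simpa [this] using hρ.2
  exact ⟨((‖φ‖⁻¹ : ℝ) : ℂ) • φ, Submodule.smul_mem _ _ hφ, by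
    rw [norm_smul]; simp [h0]⟩

theorem PosSemidef.mul_eq_zero_of_trace {M ρ : Matrix ι ι ℂ} (hM : M.PosSemidef)
    (hρ : ρ.PosSemidef) (h : (M * ρ).trace = 0) : M * ρ = 0 := by
  open scoped MatrixOrder in
  obtain ⟨A, rfl⟩ := (CStarAlgebra.nonneg_iff_eq_star_mul_self (a := M)).1 hM.nonneg
  open scoped MatrixOrder in
  obtain ⟨B, rfl⟩ := (CStarAlgebra.nonneg_iff_eq_star_mul_self (a := ρ)).1 hρ.nonneg
  simp only [Matrix.star_eq_conjTranspose] at h ⊢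
  -- With `M = A†A` and `ρ = B†B`, the trace of `M * ρ` is the squared Hilbert–Schmidt norm of
  -- `AB†`.
  have h0 : A * Bᴴ = 0 := by
    rw [← Matrix.trace_conjTranspose_mul_self_eq_zero_iff, Matrix.conjTranspose_mul,
      Matrix.conjTranspose_conjTranspose, ← h]
    simp only [Matrix.mul_assoc]
    rw [Matrix.trace_mul_comm]
    simp only [Matrix.mul_assoc]
  rw [Matrix.mul_assoc, ← Matrix.mul_assoc A, h0]
  simp

/-- Certainty forces `M` to fix the range of `ρ₀` and to annihilate that of `ρ₁`. -/
theorem PerfectlyDistinguishableStates.inner_eq_zero {ρ₀ ρ₁ : Matrix ι ι ℂ}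
    (h : PerfectlyDistinguishableStates ρ₀ ρ₁) (h₀ : IsDensity ρ₀) (h₁ : IsDensity ρ₁)
    {φ₀ φ₁ : EuclideanSpace ℂ ι} (hφ₀ : φ₀ ∈ supp ρ₀) (hφ₁ : φ₁ ∈ supp ρ₁) :
    inner ℂ φ₀ φ₁ = 0 := by
  obtain ⟨M, hM, hM', hM₀, hM₁⟩ := h
  have e₀ : (1 - M) * ρ₀ = 0 := PosSemidef.mul_eq_zero_of_trace hM' h₀.1 (by
    rw [Matrix.sub_mul, one_mul, Matrix.trace_sub, hM₀, h₀.2, sub_self])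
  have e₁ : M * ρ₁ = 0 := PosSemidef.mul_eq_zero_of_trace hM h₁.1 (by
    rw [Matrix.sub_mul, one_mul, Matrix.trace_sub, h₁.2] at hM₁
    simpa using hM₁)
  rw [Matrix.sub_mul, one_mul, sub_eq_zero] at e₀
  obtain ⟨x, rfl⟩ := hφ₀
  obtain ⟨y, rfl⟩ := hφ₁
  rw [e₀, toEuclideanLin_mul_apply, inner_toEuclideanLin_left, hM.1.eq,
    ← toEuclideanLin_mul_apply, e₁]
  simp

/-! ### Overlaps -/

/-- Among the outputs of a quantum operation on two pure states some pair overlaps at least as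
much as the inputs do. -/
theorem exists_kraus_overlap {m : ℕ} {K : Fin m → Matrix κ ι ℂ} (hK : ∑ i, (K i)ᴴ * K i = 1)
    {a b : EuclideanSpace ℂ ι} (ha : ‖a‖ = 1) (hb : ‖b‖ = 1) (hab : inner ℂ a b ≠ 0) :
    ∃ i, toEuclideanLin (K i) a ≠ 0 ∧ toEuclideanLin (K i) b ≠ 0 ∧
      ‖inner ℂ a b‖ * (‖toEuclideanLin (K i) a‖ * ‖toEuclideanLin (K i) b‖) ≤
        ‖inner ℂ (toEuclideanLin (K i) a) (toEuclideanLin (K i) b)‖ := by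
  have hsq : ∀ x : EuclideanSpace ℂ ι, ‖x‖ = 1 → ∑ i, ‖toEuclideanLin (K i) x‖ ^ 2 = 1 := by
    intro x hx
    have := sum_inner_kraus hK x x
    simp_rw [inner_self_eq_norm_sq_to_K, hx, RCLike.ofReal_one, one_pow] at this
    rw [← RCLike.ofReal_inj (K := ℂ)]
    push_cast
    exact this
  by_contra! h
  have hpos : 0 < ‖inner ℂ a b‖ := norm_pos_iff.2 hab
  have hle : ∀ i, ‖inner ℂ (toEuclideanLin (K i) a) (toEuclideanLin (K i) b)‖ ≤
      ‖inner ℂ a b‖ * (‖toEuclideanLin (K i) a‖ * ‖toEuclideanLin (K i) b‖) := by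
    intro i
    by_cases h1 : toEuclideanLin (K i) a = 0
    · simp [h1]
    by_cases h2 : toEuclideanLin (K i) b = 0
    · simp [h2]
    exact (h i h1 h2).le
  -- One branch with nonzero overlap makes the summed inequality strict, against the AM–GM bound `∑
  -- ‖Kᵢa‖‖Kᵢb‖ ≤ 1`.
  obtain ⟨j, hj⟩ : ∃ j, inner ℂ (toEuclideanLin (K j) a) (toEuclideanLin (K j) b) ≠ 0 := by
    by_contra! h0
    apply hab
    rw [← sum_inner_kraus hK a b, Finset.sum_eq_zero fun i _ => h0 i]
  have hlt := h j (fun h0 => hj (by rw [h0, inner_zero_left]))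
    (fun h0 => hj (by rw [h0, inner_zero_right]))
  have key : ‖inner ℂ a b‖ <
      ∑ i, ‖inner ℂ a b‖ * (‖toEuclideanLin (K i) a‖ * ‖toEuclideanLin (K i) b‖) := by
    calc ‖inner ℂ a b‖ = ‖∑ i, inner ℂ (toEuclideanLin (K i) a) (toEuclideanLin (K i) b)‖ := by
          rw [sum_inner_kraus hK]
      _ ≤ ∑ i, ‖inner ℂ (toEuclideanLin (K i) a) (toEuclideanLin (K i) b)‖ := norm_sum_le _ _
      _ < _ := Finset.sum_lt_sum (fun i _ => hle i) ⟨j, Finset.mem_univ j, hlt⟩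
  have hamgm : ∑ i, ‖toEuclideanLin (K i) a‖ * ‖toEuclideanLin (K i) b‖ ≤ 1 := by
    have : ∑ i, ‖toEuclideanLin (K i) a‖ * ‖toEuclideanLin (K i) b‖ ≤
        ∑ i, (‖toEuclideanLin (K i) a‖ ^ 2 + ‖toEuclideanLin (K i) b‖ ^ 2) / 2 :=
      Finset.sum_le_sum fun i _ => by
        linarith [two_mul_le_add_sq ‖toEuclideanLin (K i) a‖ ‖toEuclideanLin (K i) b‖]
    rw [← Finset.sum_div, Finset.sum_add_distrib, hsq a ha, hsq b hb] at this
    linarith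
  rw [← Finset.mul_sum] at key
  nlinarith

/-- The triangle inequality for the angle `arccos |⟨a, b⟩|` between unit vectors. -/
theorem cos_add_le_norm_inner {E : Type*} [NormedAddCommGroup E] [InnerProductSpace ℂ E]
    {a b c : E} (ha : ‖a‖ = 1) (hb : ‖b‖ = 1) (hc : ‖c‖ = 1) {s t : ℝ}
    (hs : s ∈ Set.Icc 0 (Real.pi / 2)) (ht : t ∈ Set.Icc 0 (Real.pi / 2))
    (hab : Real.cos s ≤ ‖inner ℂ a b‖) (hbc : Real.cos t ≤ ‖inner ℂ b c‖) :
    Real.cos (s + t) ≤ ‖inner ℂ a c‖ := by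
  have hb2 : inner ℂ b b = 1 := by rw [inner_self_eq_norm_sq_to_K, hb]; simp
  -- The component orthogonal to `b` has length the sine of the angle to `b`.
  have perp : ∀ x : E, ‖x‖ = 1 → ‖x - inner ℂ b x • b‖ ^ 2 = 1 - ‖inner ℂ b x‖ ^ 2 := by
    intro x hx
    have h := norm_sub_sq (𝕜 := ℂ) x (inner ℂ b x • b)
    rw [inner_smul_right, ← inner_conj_symm x b, RCLike.mul_conj, hx, norm_smul, hb] at h
    norm_cast at h
    rw [h]
    norm_num
    ring
  have hsplit : inner ℂ a c = inner ℂ a b * inner ℂ b c +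
      inner ℂ (a - inner ℂ b a • b) (c - inner ℂ b c • b) := by
    simp only [inner_sub_left, inner_sub_right, inner_smul_left, inner_smul_right, hb2,
      inner_conj_symm]
    ring
  have hba : ‖inner ℂ b a‖ = ‖inner ℂ a b‖ := norm_inner_symm _ _
  have hcs0 := Real.cos_nonneg_of_mem_Icc (x := s) ⟨by linarith [hs.1, Real.pi_pos], hs.2⟩
  have hct0 := Real.cos_nonneg_of_mem_Icc (x := t) ⟨by linarith [ht.1, Real.pi_pos], ht.2⟩
  have hss0 := Real.sin_nonneg_of_nonneg_of_le_pi hs.1 (by linarith [hs.2, Real.pi_pos])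
  have hst0 := Real.sin_nonneg_of_nonneg_of_le_pi ht.1 (by linarith [ht.2, Real.pi_pos])
  have h1 : ‖a - inner ℂ b a • b‖ ≤ Real.sin s := by
    apply le_of_sq_le_sq _ hss0
    rw [perp a ha, hba, Real.sin_sq]
    gcongr
  have h2 : ‖c - inner ℂ b c • b‖ ≤ Real.sin t := by
    apply le_of_sq_le_sq _ hst0
    rw [perp c hc, Real.sin_sq]
    gcongr
  have h3 := norm_inner_le_norm (𝕜 := ℂ) (a - inner ℂ b a • b) (c - inner ℂ b c • b)
  have h4 : ‖a - inner ℂ b a • b‖ * ‖c - inner ℂ b c • b‖ ≤ Real.sin s * Real.sin t := by gcongr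
  have h5 : Real.cos s * Real.cos t ≤ ‖inner ℂ a b * inner ℂ b c‖ := by
    rw [norm_mul]; gcongr
  have h6 : ‖inner ℂ a b * inner ℂ b c‖ ≤ ‖inner ℂ a c‖ +
      ‖inner ℂ (a - inner ℂ b a • b) (c - inner ℂ b c • b)‖ := by
    rw [eq_sub_of_add_eq hsplit.symm]
    exact norm_sub_le _ _
  rw [Real.cos_add]
  linarith

/-- The maximal fidelity with a pure state is attained, at the projection of its vector. -/
theorem exists_mem_supp_maxFidelity_le {ρ : Matrix ι ι ℂ} {ψ : EuclideanSpace ℂ ι}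
    (hψ : ‖ψ‖ = 1) (h : 0 < maxFidelity ρ (pureState ψ)) :
    ∃ w ∈ supp ρ, ‖w‖ = 1 ∧ maxFidelity ρ (pureState ψ) ≤ ‖inner ℂ w ψ‖ := by
  set p := (supp ρ).starProjection ψ with hp
  have hpm : p ∈ supp ρ := (supp ρ).starProjection_apply_mem ψ
  have hin : ∀ w ∈ supp ρ, inner ℂ w ψ = inner ℂ w p := by
    intro w hw
    rw [hp, ← Submodule.inner_starProjection_left_eq_right,
      Submodule.starProjection_eq_self_iff.2 hw]
  have hle : maxFidelity ρ (pureState ψ) ≤ ‖p‖ := by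
    refine Real.sSup_le ?_ (norm_nonneg _)
    rintro x ⟨φ₀, h₀, φ₁, h₁, n₀, n₁, rfl⟩
    obtain ⟨c, rfl⟩ := exists_eq_smul_of_mem_supp_pureState h₁
    have hc : ‖c‖ = 1 := by simpa [norm_smul, hψ] using n₁
    rw [inner_smul_right, norm_mul, hc, one_mul, hin _ h₀]
    simpa [n₀] using norm_inner_le_norm (𝕜 := ℂ) φ₀ p
  have hp0 : 0 < ‖p‖ := h.trans_le hle
  refine ⟨((‖p‖⁻¹ : ℝ) : ℂ) • p, Submodule.smul_mem _ _ hpm, ?_, hle.trans ?_⟩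
  · rw [norm_smul]
    simp [hp0.ne']
  · rw [inner_smul_left, hin p hpm, inner_self_eq_norm_sq_to_K, norm_mul]
    simp only [RCLike.norm_conj, norm_pow, Complex.norm_real, norm_inv, norm_norm,
      Complex.coe_algebraMap]
    field_simp
    exact le_rfl

theorem maxFidelity_nonneg (ρ₀ ρ₁ : Matrix ι ι ℂ) : 0 ≤ maxFidelity ρ₀ ρ₁ := by
  refine Real.sSup_nonneg ?_
  rintro x ⟨_, _, _, _, _, _, rfl⟩
  exact norm_nonneg _

theorem qMaxFidelity_one_le (Φ₀ Φ₁ : SuperOp ι κ) {ψ : EuclideanSpace ℂ ι} (hψ : ‖ψ‖ = 1) :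
    qMaxFidelity 1 Φ₀ Φ₁ ≤ maxFidelity (Φ₀ (pureState ψ)) (Φ₁ (pureState ψ)) := by
  refine csInf_le ⟨0, ?_⟩ ⟨ψ, ψ, hψ, hψ, ?_, rfl⟩
  · rintro x ⟨_, _, _, _, _, rfl⟩
    exact maxFidelity_nonneg _ _
  · rw [inner_self_eq_norm_sq_to_K, hψ]
    simp

/-! ### Reduction to an auxiliary system of the dimension of the queried system -/

/-- An orthonormal basis of `W`, padded with zero vectors to length `d`. As `r < d` is allowed, the
`v k` cannot be required to be orthonormal. -/
theorem exists_frame {r d : ℕ} (W : Submodule ℂ (EuclideanSpace ℂ (Fin r)))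
    (hW : Module.finrank ℂ W ≤ d) :
    ∃ v : Fin d → EuclideanSpace ℂ (Fin r), ∀ x ∈ W, ∑ k, inner ℂ (v k) x • v k = x := by
  let b := stdOrthonormalBasis ℂ W
  have hinj : Function.Injective (Fin.castLE hW) := Fin.castLE_injective hW
  refine ⟨Function.extend (Fin.castLE hW) (fun k => (b k : EuclideanSpace ℂ (Fin r))) 0, ?_⟩
  intro x hx
  have h := congrArg Subtype.val (b.sum_repr' ⟨x, hx⟩)
  rw [AddSubmonoidClass.coe_finsetSum] at h
  refine Eq.trans (Eq.symm ?_) h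
  refine Fintype.sum_of_injective _ hinj _ _ ?_ ?_
  · intro i hi
    rw [Function.extend_apply' _ _ _ hi]
    simp
  · intro i
    rw [hinj.extend_apply]
    rfl

/-- Every vector of `ℂʳ ⊗ ℂᵈ` is fixed by some `V V† ⊗ 1` with `V : ℂᵈ → ℂʳ`. -/
theorem exists_schmidt {r d : ℕ} (φ : EuclideanSpace ℂ (Fin r × Fin d)) :
    ∃ V : Matrix (Fin r) (Fin d) ℂ,
      toEuclideanLin ((V * Vᴴ) ⊗ₖ (1 : Matrix (Fin d) (Fin d) ℂ)) φ = φ := by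
  let col : Fin d → EuclideanSpace ℂ (Fin r) := fun i => WithLp.toLp 2 fun s => φ (s, i)
  obtain ⟨v, hv⟩ := exists_frame (d := d) (Submodule.span ℂ (Set.range col))
    ((finrank_range_le_card col).trans (by simp))
  refine ⟨Matrix.of fun s k => v k s, ?_⟩
  ext ⟨s, i⟩
  have h := congrArg (fun x : EuclideanSpace ℂ (Fin r) => x s)
    (hv (col i) (Submodule.subset_span ⟨i, rfl⟩))
  simp only [WithLp.ofLp_sum, Finset.sum_apply, PiLp.smul_apply, smul_eq_mul,
    EuclideanSpace.inner_eq_star_dotProduct, dotProduct, col, Pi.star_apply] at h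
  rw [← h]
  simp only [Matrix.ofLp_toLpLin, Matrix.toLin'_apply, Matrix.mulVec, dotProduct,
    Fintype.sum_prod_type, Matrix.kronecker_apply, Matrix.mul_apply, Matrix.one_apply,
    Matrix.conjTranspose_apply, Matrix.of_apply, mul_ite, mul_one, mul_zero, ite_mul, zero_mul,
    Finset.sum_ite_eq, Finset.mem_univ, if_true, Finset.sum_mul]
  rw [Finset.sum_comm]
  exact Finset.sum_congr rfl fun k _ => Finset.sum_congr rfl fun t _ => by ring

/-- Covers both unitaries and the compression `V† ⊗ 1`, which need preserve inner products only on a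
subspace. -/
theorem inner_toEuclideanLin_of_fixed {A : Matrix κ ι ℂ} {x y : EuclideanSpace ℂ ι}
    (hy : toEuclideanLin (Aᴴ * A) y = y) :
    inner ℂ (toEuclideanLin A x) (toEuclideanLin A y) = inner ℂ x y := by
  rw [inner_toEuclideanLin_left, ← toEuclideanLin_mul_apply, hy]

theorem norm_toEuclideanLin_of_fixed {A : Matrix κ ι ℂ} {x : EuclideanSpace ℂ ι}
    (hx : toEuclideanLin (Aᴴ * A) x = x) : ‖toEuclideanLin A x‖ = ‖x‖ := by
  rw [norm_eq_sqrt_re_inner (𝕜 := ℂ), norm_eq_sqrt_re_inner (𝕜 := ℂ) x,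
    inner_toEuclideanLin_of_fixed hx]

theorem one_kronecker_isometry (R : Type) [Fintype R] [DecidableEq R] {U : Matrix ι ι ℂ}
    (hU : Uᴴ * U = 1) (x : EuclideanSpace ℂ (R × ι)) :
    toEuclideanLin (((1 : Matrix R R ℂ) ⊗ₖ U)ᴴ * ((1 : Matrix R R ℂ) ⊗ₖ U)) x = x := by
  rw [Matrix.conjTranspose_kronecker, ← Matrix.mul_kronecker_mul, hU]
  simp [Matrix.toEuclideanLin]

/-- On a pure input with any auxiliary system, the output of `E` contains a vector whose overlap
with the output of the unitary is at least the entanglement-assisted `1`-maximal fidelity. -/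
theorem exists_query_overlap {r d m : ℕ} {U : Matrix (Fin d) (Fin d) ℂ} (hU : Uᴴ * U = 1)
    (hU' : U * Uᴴ = 1) {E : SuperOp (Fin d) (Fin d)} {K : Fin m → Matrix (Fin d) (Fin d) ℂ}
    (hE : ∀ ρ, E ρ = ∑ i, K i * ρ * (K i)ᴴ)
    (hF : 0 < eaMaxFidelity 1 (conjOp Uᴴ ∘ₗ E) LinearMap.id)
    {φ : EuclideanSpace ℂ (Fin r × Fin d)} (hφ : ‖φ‖ = 1) :
    ∃ c : Fin m → ℂ,
      ‖∑ i, c i • toEuclideanLin ((1 : Matrix (Fin r) (Fin r) ℂ) ⊗ₖ K i) φ‖ = 1 ∧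
      eaMaxFidelity 1 (conjOp Uᴴ ∘ₗ E) LinearMap.id ≤
        ‖inner ℂ (toEuclideanLin ((1 : Matrix (Fin r) (Fin r) ℂ) ⊗ₖ U) φ)
          (∑ i, c i • toEuclideanLin ((1 : Matrix (Fin r) (Fin r) ℂ) ⊗ₖ K i) φ)‖ := by
  obtain ⟨V, hV⟩ := exists_schmidt φ
  have hT : (Vᴴ ⊗ₖ (1 : Matrix (Fin d) (Fin d) ℂ))ᴴ * (Vᴴ ⊗ₖ (1 : Matrix (Fin d) (Fin d) ℂ)) =
      (V * Vᴴ) ⊗ₖ (1 : Matrix (Fin d) (Fin d) ℂ) := by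
    rw [Matrix.conjTranspose_kronecker, ← Matrix.mul_kronecker_mul]
    simp
  set T := Vᴴ ⊗ₖ (1 : Matrix (Fin d) (Fin d) ℂ) with hTdef
  rw [← hT] at hV
  have hψ : ‖toEuclideanLin T φ‖ = 1 := (norm_toEuclideanLin_of_fixed hV).trans hφ
  have hE' : ∀ ρ, (conjOp Uᴴ ∘ₗ E) ρ = ∑ i, (Uᴴ * K i) * ρ * (Uᴴ * K i)ᴴ := by
    intro ρ
    simp [conjOp, hE, Finset.mul_sum, Finset.sum_mul, Matrix.mul_assoc]
  have hid : idTensor (Fin d) (LinearMap.id : SuperOp (Fin d) (Fin d))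
      (pureState (toEuclideanLin T φ)) = pureState (toEuclideanLin T φ) := rfl
  have hFle := qMaxFidelity_one_le (idTensor (Fin d) (conjOp Uᴴ ∘ₗ E))
    (idTensor (Fin d) LinearMap.id) hψ
  rw [hid] at hFle
  obtain ⟨w, hw, hw1, hwF⟩ := exists_mem_supp_maxFidelity_le hψ (hF.trans_le hFle)
  rw [idTensor_kraus (Fin d) hE'] at hw
  obtain ⟨c, rfl⟩ := exists_eq_sum_of_mem_supp_kraus _ _ hw
  have hcomm : ∀ A : Matrix (Fin d) (Fin d) ℂ,
      toEuclideanLin ((1 : Matrix (Fin d) (Fin d) ℂ) ⊗ₖ A) (toEuclideanLin T φ) =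
        toEuclideanLin T (toEuclideanLin ((1 : Matrix (Fin r) (Fin r) ℂ) ⊗ₖ A) φ) := by
    intro A
    rw [← toEuclideanLin_mul_apply, ← toEuclideanLin_mul_apply, hTdef,
      ← Matrix.mul_kronecker_mul, ← Matrix.mul_kronecker_mul]
    simp
  -- Operators on the queried factor commute with `VV† ⊗ 1`, so the compression stays isometric on
  -- every image of `φ` under them.
  have hfix : ∀ A : Matrix (Fin d) (Fin d) ℂ,
      toEuclideanLin (Tᴴ * T) (toEuclideanLin ((1 : Matrix (Fin r) (Fin r) ℂ) ⊗ₖ A) φ) =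
        toEuclideanLin ((1 : Matrix (Fin r) (Fin r) ℂ) ⊗ₖ A) φ := by
    intro A
    conv_rhs => rw [← hV]
    rw [← toEuclideanLin_mul_apply, ← toEuclideanLin_mul_apply, hT,
      ← Matrix.mul_kronecker_mul, ← Matrix.mul_kronecker_mul]
    simp
  set u := ∑ i, c i • toEuclideanLin ((1 : Matrix (Fin r) (Fin r) ℂ) ⊗ₖ (Uᴴ * K i)) φ with hu
  have hTu : ∑ i, c i • toEuclideanLin ((1 : Matrix (Fin d) (Fin d) ℂ) ⊗ₖ (Uᴴ * K i))
      (toEuclideanLin T φ) = toEuclideanLin T u := by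
    simp_rw [hu, map_sum, map_smul, hcomm]
  have hu_fix : toEuclideanLin (Tᴴ * T) u = u := by
    simp_rw [hu, map_sum, map_smul, hfix]
  have hUu : ∑ i, c i • toEuclideanLin ((1 : Matrix (Fin r) (Fin r) ℂ) ⊗ₖ K i) φ =
      toEuclideanLin ((1 : Matrix (Fin r) (Fin r) ℂ) ⊗ₖ U) u := by
    simp_rw [hu, map_sum, map_smul, ← toEuclideanLin_mul_apply, ← Matrix.mul_kronecker_mul,
      one_mul, ← Matrix.mul_assoc, hU', one_mul]
  rw [hTu] at hw1 hwF
  refine ⟨c, ?_, ?_⟩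
  · rw [hUu, norm_toEuclideanLin_of_fixed (one_kronecker_isometry _ hU _),
      ← norm_toEuclideanLin_of_fixed hu_fix, hw1]
  · rw [hUu, inner_toEuclideanLin_of_fixed (one_kronecker_isometry _ hU _), norm_inner_symm,
      ← inner_toEuclideanLin_of_fixed hV]
    exact hFle.trans hwF

/-- A known quantum operation does not decrease the largest overlap of the supports. -/
theorem IsQuantumOperation.exists_overlap {Φ : SuperOp ι κ} (hΦ : IsQuantumOperation Φ)
    {ρ₀ ρ₁ : Matrix ι ι ℂ} (h₀ : ρ₀.PosSemidef) (h₁ : ρ₁.PosSemidef)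
    {a b : EuclideanSpace ℂ ι} (ha : a ∈ supp ρ₀) (hb : b ∈ supp ρ₁) (ha1 : ‖a‖ = 1)
    (hb1 : ‖b‖ = 1) (hab : inner ℂ a b ≠ 0) :
    ∃ φ₀ ∈ supp (Φ ρ₀), ∃ φ₁ ∈ supp (Φ ρ₁), ‖φ₀‖ = 1 ∧ ‖φ₁‖ = 1 ∧
      ‖inner ℂ a b‖ ≤ ‖inner ℂ φ₀ φ₁‖ := by
  obtain ⟨m, K, hK, hΦ⟩ := hΦ
  obtain ⟨i, hi₀, hi₁, hi⟩ := exists_kraus_overlap hK ha1 hb1 hab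
  rw [hΦ, hΦ]
  refine ⟨((‖toEuclideanLin (K i) a‖⁻¹ : ℝ) : ℂ) • toEuclideanLin (K i) a,
    Submodule.smul_mem _ _ (kraus_mem_supp K h₀ ha i),
    ((‖toEuclideanLin (K i) b‖⁻¹ : ℝ) : ℂ) • toEuclideanLin (K i) b,
    Submodule.smul_mem _ _ (kraus_mem_supp K h₁ hb i), ?_, ?_, ?_⟩
  · rw [norm_smul, Complex.norm_real, norm_inv, norm_norm, inv_mul_cancel₀ (norm_ne_zero_iff.2 hi₀)]
  · rw [norm_smul, Complex.norm_real, norm_inv, norm_norm, inv_mul_cancel₀ (norm_ne_zero_iff.2 hi₁)]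
  · rw [inner_smul_left, inner_smul_right, norm_mul, norm_mul, RCLike.norm_conj,
      Complex.norm_real, Complex.norm_real, norm_inv, norm_inv, norm_norm, norm_norm]
    have p₀ := norm_pos_iff.2 hi₀
    have p₁ := norm_pos_iff.2 hi₁
    calc ‖inner ℂ a b‖ = ‖toEuclideanLin (K i) a‖⁻¹ * (‖toEuclideanLin (K i) b‖⁻¹ *
          (‖inner ℂ a b‖ * (‖toEuclideanLin (K i) a‖ * ‖toEuclideanLin (K i) b‖))) := by
          field_simp
      _ ≤ _ := by gcongr

/-- Each query enlarges the angle between the supports by at most `arccos F`, where `F` is the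
entanglement-assisted `1`-maximal fidelity. -/
theorem Scheme.exists_overlap {d : ℕ} (S : Scheme (Fin d)) {U : Matrix (Fin d) (Fin d) ℂ}
    (hU : Uᴴ * U = 1) (hU' : U * Uᴴ = 1) {E : SuperOp (Fin d) (Fin d)}
    (hE : IsQuantumOperation E) (n : ℕ)
    (hn : n * Real.arccos (eaMaxFidelity 1 (conjOp Uᴴ ∘ₗ E) LinearMap.id) < Real.pi / 2) :
    ∃ φ₀ ∈ supp (S.state (conjOp U) n), ∃ φ₁ ∈ supp (S.state E n), ‖φ₀‖ = 1 ∧ ‖φ₁‖ = 1 ∧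
      Real.cos (n * Real.arccos (eaMaxFidelity 1 (conjOp Uᴴ ∘ₗ E) LinearMap.id)) ≤
        ‖inner ℂ φ₀ φ₁‖ := by
  set F := eaMaxFidelity 1 (conjOp Uᴴ ∘ₗ E) LinearMap.id with hFdef
  have hα := Real.arccos_nonneg F
  induction n with
  | zero =>
    obtain ⟨φ, hφ, h1⟩ := S.init_isDensity.exists_mem_supp
    refine ⟨φ, hφ, φ, hφ, h1, h1, ?_⟩
    rw [inner_self_eq_norm_sq_to_K, h1]
    simp
  | succ k ih =>
    rw [Nat.cast_succ, add_one_mul] at hn ⊢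
    have hk0 : 0 ≤ k * Real.arccos F := by positivity
    obtain ⟨φ₀, h₀, φ₁, h₁, n₀, n₁, hcos⟩ := ih (by linarith)
    -- At least one query is counted here, so `arccos F < π / 2`.
    have hF : 0 < F := Real.arccos_lt_pi_div_two.1 (by linarith)
    have hUq := conjOp_isQuantumOperation hU
    have d₀ := S.state_isDensity hUq k
    have d₁ := S.state_isDensity hE k
    have hUK : ∀ ρ, conjOp U ρ = ∑ i : Fin 1, (fun _ => U) i * ρ * ((fun _ => U) i)ᴴ := by
      intro ρ
      simp [conjOp]
    obtain ⟨m, K, hK, hEK⟩ := id hE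
    obtain ⟨c, hw1, hwF⟩ := exists_query_overlap (φ := φ₁) hU hU' hEK hF n₁
    rw [← hFdef] at hwF
    set w := ∑ i, c i • toEuclideanLin
      ((1 : Matrix (Fin (S.aux k)) (Fin (S.aux k)) ℂ) ⊗ₖ K i) φ₁ with hwdef
    have iso := fun x => one_kronecker_isometry (Fin (S.aux k)) hU x
    have hwmem : w ∈ supp (idTensor (Fin (S.aux k)) E (S.state E k)) := by
      rw [idTensor_kraus _ hEK]
      exact Submodule.sum_mem _ fun i _ => Submodule.smul_mem _ _ (kraus_mem_supp _ d₁.1 h₁ i)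
    have hamem : toEuclideanLin ((1 : Matrix (Fin (S.aux k)) (Fin (S.aux k)) ℂ) ⊗ₖ U) φ₀ ∈
        supp (idTensor (Fin (S.aux k)) (conjOp U) (S.state (conjOp U) k)) := by
      rw [idTensor_kraus _ hUK]
      exact kraus_mem_supp (fun _ : Fin 1 => (1 : Matrix (Fin (S.aux k)) (Fin (S.aux k)) ℂ) ⊗ₖ U)
        d₀.1 h₀ 0
    have ha1 := (norm_toEuclideanLin_of_fixed (iso φ₀)).trans n₀
    have hb1 := (norm_toEuclideanLin_of_fixed (iso φ₁)).trans n₁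
    -- The image of `φ₁` under `1 ⊗ U` is the middle vector of the triangle inequality.
    rw [← inner_toEuclideanLin_of_fixed (iso φ₁)] at hcos
    -- `Real.arccos` is constant beyond `1`, so `F ≤ 1` is needed; it holds because `F` is bounded
    -- by an overlap of unit vectors.
    have hcosα : Real.cos (Real.arccos F) = F := by
      refine Real.cos_arccos (by linarith) (hwF.trans ?_)
      simpa [hb1, hw1] using norm_inner_le_norm (𝕜 := ℂ)
        (toEuclideanLin ((1 : Matrix (Fin (S.aux k)) (Fin (S.aux k)) ℂ) ⊗ₖ U) φ₁) w
    have htri := cos_add_le_norm_inner ha1 hb1 hw1 ⟨hk0, by linarith⟩ ⟨hα, by linarith⟩ hcos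
      (hcosα.trans_le hwF)
    have hpos := Real.cos_pos_of_mem_Ioo
      ⟨by linarith [Real.pi_pos, add_nonneg hk0 hα], hn⟩
    obtain ⟨ψ₀, m₀, ψ₁, m₁, l₀, l₁, hle⟩ := (S.op_isQuantumOperation k).exists_overlap
      ((hUq.idTensor _).isDensity d₀).1 ((hE.idTensor _).isDensity d₁).1 hamem hwmem ha1 hw1
      (norm_pos_iff.1 (hpos.trans_le htri))
    exact ⟨ψ₀, m₀, ψ₁, m₁, l₀, l₁, htri.trans hle⟩

theorem DistinguishableIn.pi_div_two_le {d n : ℕ} {U : Matrix (Fin d) (Fin d) ℂ}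
    (hU : Uᴴ * U = 1) (hU' : U * Uᴴ = 1) {E : SuperOp (Fin d) (Fin d)}
    (hE : IsQuantumOperation E) (h : DistinguishableIn n (conjOp U) E) :
    Real.pi / 2 ≤ n * Real.arccos (eaMaxFidelity 1 (conjOp Uᴴ ∘ₗ E) LinearMap.id) := by
  obtain ⟨S, hS⟩ := h
  by_contra! hlt
  obtain ⟨φ₀, h₀, φ₁, h₁, -, -, hle⟩ := S.exists_overlap hU hU' hE n hlt
  rw [hS.inner_eq_zero (S.state_isDensity (conjOp_isQuantumOperation hU) n)
    (S.state_isDensity hE n) h₀ h₁, norm_zero] at hle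
  refine hle.not_gt (Real.cos_pos_of_mem_Ioo ⟨?_, hlt⟩)
  have := mul_nonneg (Nat.cast_nonneg (α := ℝ) n)
    (Real.arccos_nonneg (eaMaxFidelity 1 (conjOp Uᴴ ∘ₗ E) LinearMap.id))
  linarith [Real.pi_pos]

end QDisc

theorem mainTheorem5 {d : ℕ} (U : Matrix (Fin d) (Fin d) ℂ)
    (hU : U ∈ Matrix.unitaryGroup (Fin d) ℂ)
    (E : QDisc.SuperOp (Fin d) (Fin d)) (hE : QDisc.IsQuantumOperation E)
    (hdist : QDisc.PerfectlyDistinguishable (QDisc.conjOp U) E) :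
    QDisc.eaMaxFidelity 1 (QDisc.conjOp Uᴴ ∘ₗ E) LinearMap.id < 1 ∧
    ⌈Real.pi / (2 * Real.arccos
        (QDisc.eaMaxFidelity 1 (QDisc.conjOp Uᴴ ∘ₗ E) LinearMap.id))⌉₊ ≤
      QDisc.minQueries (QDisc.conjOp U) E := by
  -- The natural-number infimum is attained because `hdist` makes the set nonempty.
  have hmin : QDisc.DistinguishableIn (QDisc.minQueries (QDisc.conjOp U) E) (QDisc.conjOp U) E :=
    Nat.sInf_mem hdist
  have hle := hmin.pi_div_two_le (Matrix.mem_unitaryGroup_iff'.1 hU)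
    (Matrix.mem_unitaryGroup_iff.1 hU) hE
  have hα : 0 < Real.arccos (QDisc.eaMaxFidelity 1 (QDisc.conjOp Uᴴ ∘ₗ E) LinearMap.id) := by
    refine (Real.arccos_nonneg _).lt_of_ne fun h => ?_
    rw [← h, mul_zero] at hle
    linarith [Real.pi_pos]
  refine ⟨Real.arccos_pos.1 hα, Nat.ceil_le.2 ?_⟩
  rw [div_le_iff₀ (by positivity)]
  linarith
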